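/- Let $N\ge 2$ and $d\ge 1$ be integers, let $\Omega=\mathbb{R}^d$ carry the $\ell_1$ norm $|\cdot|$, and let $S_k(x_1,\dots,x_N)=x_k$ ($1\le k\le N$) be the coordinate process on $\Omega^N$ with natural filtration $\mathcal F_k=\sigma(S_1,\dots,S_k)$. Let $\mathcal P$ be the set of Borel probability measures on $\Omega$ with finite first moment, let $\mathcal W(\mu,\nu)=\inf_{\pi}\int|x-y|\,\pi(dx,dy)$ be the Wasserstein distance of order 1 on $\mathcal P$ (infimum over all couplings $\pi$ of $\mu$ and $\nu$), and for $\boldsymbol\mu,\boldsymbol\nu\in\mathcal P^N$ put $\mathcal W^{\oplus}(\boldsymbol\mu,\boldsymbol\nu)=\sum_{k=1}^N\mathcal W(\mu_k,\nu_k)$. For $\varepsilon\ge 0$ let $\mathcal M_\varepsilon(\boldsymbol\mu)$ be the set of probability measures $\mathbb P$ on $\Omega^N$ with finite first moment such that $\mathbb P\circ S_k^{-1}=\mu_k$ for $k=1,\dots,N$ and $$\mathbb E_{\mathbb P}\Big[\big|\mathbb E_{\mathbb P}[S_{k+1}\mid\mathcal F_k]-S_k\big|\Big]\le\varepsilon\qquad\text{for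 } k=1,\dots,N-1 .$$ For $c:\Omega^N\to\mathbb R$ let $\mathsf P_\varepsilon(\boldsymbol\mu)=\sup_{\mathbb P\in\mathcal M_\varepsilon(\boldsymbol\mu)}\mathbb E_{\mathbb P}[c(S_1,\dots,S_N)]$, with $\sup\emptyset=-\infty$, and write $\mathsf P(\boldsymbol\mu)=\mathsf P_0(\boldsymbol\mu)$ (the martingale optimal transport value). An optimizer for $\mathsf P_\varepsilon(\boldsymbol\mu)$ is a $\mathbb P\in\mathcal M_\varepsilon(\boldsymbol\mu)$ with $\mathbb E_{\mathbb P}[c]=\mathsf P_\varepsilon(\boldsymbol\mu)$. **Theorem.** Let $\boldsymbol\mu\in\mathcal P^N$ with $\mathcal M_0(\boldsymbol\mu)\ne\emptyset$, let $(\boldsymbol\mu^n)_{n\ge1}\subset\mathcal P^N$ satisfy $r_n:=\mathcal W^{\oplus}(\boldsymbol\mu^n,\boldsymbol\mu)\to 0$. Then $\mathcal M_{r_n}(\boldsymbol\mu^n)\neq\emptyset$ for all $n\ge1$. Assume further that $c$ is Lipschitz, and let $(\varepsilon_n)_{n\ge1}$ be any real sequence with $\varepsilon_n\to0$ and $\varepsilon_n\ge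 r_n$ for all $n$. Then: (i) $\lim_{n\to\infty}\mathsf P_{\varepsilon_n}(\boldsymbol\mu^n)=\mathsf P(\boldsymbol\mu)$. (ii) For each $n\ge1$ there is an optimizer for $\mathsf P_{\varepsilon_n}(\boldsymbol\mu^n)$. For any choice of optimizers $\mathbb P_n$ for $\mathsf P_{\varepsilon_n}(\boldsymbol\mu^n)$, $n\ge1$, the sequence $(\mathbb P_n)_{n\ge1}$ is tight, and every weak limit of a subsequence is an optimizer for $\mathsf P(\boldsymbol\mu)$. If $\mathsf P(\boldsymbol\mu)$ has a unique optimizer, then $(\mathbb P_n)_{n\ge1}$ converges weakly to it. -/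

import Mathlib

open MeasureTheory ProbabilityTheory Filter Topology

noncomputable section

namespace RelaxedMOT

/-- The state space `Ω = ℝ^d`, endowed with the `ℓ¹` norm. -/
abbrev Space (d : ℕ) : Type := PiLp 1 (fun _ : Fin d => ℝ)

/-- The path space `Ω^N`; the coordinate process is `S_k ω = ω k`, with times indexed by `Fin N`. It
carries the product topology and the product (= Borel) `σ`-algebra. Its norm is the maximum of the
`ℓ¹` norms of the coordinates, which is equivalent to the `ℓ¹` norm of the whole path, hence gives
the same Lipschitz functions and the same measures with finite first moment. -/
abbrev PathSpace (N d : ℕ) : Type := Fin N → Space d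

/-- `𝒫(E)`: the Borel probability measures on `E` with a finite first moment. -/
abbrev FiniteMomentMeasure (E : Type) [NormedAddCommGroup E] [MeasurableSpace E] : Type :=
  {μ : ProbabilityMeasure E // Integrable (fun x : E => ‖x‖) (μ : Measure E)}

/-- The law of `FiniteMomentMeasure`, as a measure. -/
abbrev FiniteMomentMeasure.law {E : Type} [NormedAddCommGroup E] [MeasurableSpace E]
    (μ : FiniteMomentMeasure E) : Measure E :=
  ((μ.1 : ProbabilityMeasure E) : Measure E)

/-- The transport plans between two measures, as probability measures on `Ω × Ω` with the given
marginals. -/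
def couplings {d : ℕ} (μ ν : FiniteMomentMeasure (Space d)) :
    Set (ProbabilityMeasure (Space d × Space d)) :=
  {π | (π : Measure (Space d × Space d)).map Prod.fst = μ.law ∧
    (π : Measure (Space d × Space d)).map Prod.snd = ν.law}

/-- The Wasserstein distance of order one, `𝒲(μ, ν) = inf_π E_π |x - y|`. (The integrals are
finite, since both marginals have a finite first moment.) -/
def wasserstein {d : ℕ} (μ ν : FiniteMomentMeasure (Space d)) : ℝ :=
  ⨅ π : couplings μ ν, ∫ z, ‖z.1 - z.2‖ ∂(π.1 : Measure (Space d × Space d))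

/-- The summed Wasserstein metric `𝒲^⊕(μ, ν) = ∑ k, 𝒲(μ_k, ν_k)` on `𝒫^N`. -/
def wassersteinSum {N d : ℕ} (μ ν : Fin N → FiniteMomentMeasure (Space d)) : ℝ :=
  ∑ k, wasserstein (μ k) (ν k)

/-- `𝒫(μ)`: the probability measures on `Ω^N` with finite first moment and marginals
`μ_1, …, μ_N`. -/
def transportPlans {N d : ℕ} (μ : Fin N → FiniteMomentMeasure (Space d)) :
    Set (ProbabilityMeasure (PathSpace N d)) :=
  {P | Integrable (fun ω : PathSpace N d => ‖ω‖) (P : Measure (PathSpace N d)) ∧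
    ∀ k, (P : Measure (PathSpace N d)).map (fun ω => ω k) = (μ k).law}

/-- The natural filtration `ℱ_k = σ(S_1, …, S_k)` of the coordinate process. -/
def coordFiltration (N d : ℕ) :
    Filtration (Fin N) (inferInstance : MeasurableSpace (PathSpace N d)) :=
  Filtration.natural (fun (k : Fin N) (ω : PathSpace N d) => ω k)
    (fun k => (measurable_pi_apply k).stronglyMeasurable)

/-- `P` is an `ε`-approximating martingale measure: `E_P |E_P[S_{k+1} | ℱ_k] - S_k| ≤ ε` for every
time `k` that has a successor. -/
def IsApproxMartingale {N d : ℕ} (ε : ℝ) (P : ProbabilityMeasure (PathSpace N d)) : Prop :=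
  ∀ (k : Fin N) (hk : (k : ℕ) + 1 < N),
    ∫ ω, ‖((P : Measure (PathSpace N d))[fun ω' : PathSpace N d => ω' ⟨(k : ℕ) + 1, hk⟩ |
        coordFiltration N d k]) ω - ω k‖ ∂(P : Measure (PathSpace N d)) ≤ ε

/-- `ℳ_ε(μ)`: the `ε`-approximating martingale measures with marginals `μ`. For `ε = 0` these are
the martingale measures with marginals `μ`. -/
def approxMartingaleMeasures {N d : ℕ} (ε : ℝ) (μ : Fin N → FiniteMomentMeasure (Space d)) :
    Set (ProbabilityMeasure (PathSpace N d)) :=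
  {P | P ∈ transportPlans μ ∧ IsApproxMartingale ε P}

/-- The value `P_ε(μ) = sup { E_P[c] : P ∈ ℳ_ε(μ) }` of the relaxed martingale optimal transport
problem; it is `-∞` if `ℳ_ε(μ)` is empty, and the value of the martingale optimal transport
problem if `ε = 0`. It is used for Lipschitz `c`, whose expectations are finite. -/
def relaxedValue {N d : ℕ} (c : PathSpace N d → ℝ) (ε : ℝ)
    (μ : Fin N → FiniteMomentMeasure (Space d)) : EReal :=
  ⨆ P ∈ approxMartingaleMeasures ε μ, ((∫ ω, c ω ∂(P : Measure (PathSpace N d)) : ℝ) : EReal)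

/-- `P` is an optimizer for `P_ε(μ)`: `P ∈ ℳ_ε(μ)` and `P_ε(μ) = E_P[c]`. -/
def IsOptimizer {N d : ℕ} (c : PathSpace N d → ℝ) (ε : ℝ)
    (μ : Fin N → FiniteMomentMeasure (Space d)) (P : ProbabilityMeasure (PathSpace N d)) : Prop :=
  P ∈ approxMartingaleMeasures ε μ ∧
    relaxedValue c ε μ = ((∫ ω, c ω ∂(P : Measure (PathSpace N d)) : ℝ) : EReal)

/-- The expectations that enter `relaxedValue` are genuine for Lipschitz rewards. -/
theorem integrable_reward {N d : ℕ} {c : PathSpace N d → ℝ} {K : NNReal} (hc : LipschitzWith K c)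
    {μ : Fin N → FiniteMomentMeasure (Space d)} {P : ProbabilityMeasure (PathSpace N d)}
    (hP : P ∈ transportPlans μ) : Integrable c (P : Measure (PathSpace N d)) := by
  have h1 : Integrable (fun ω : PathSpace N d => ‖c 0‖ + K * ‖ω‖) (P : Measure (PathSpace N d)) :=
    (integrable_const _).add (hP.1.const_mul _)
  refine h1.mono' hc.continuous.measurable.aestronglyMeasurable (Eventually.of_forall fun ω => ?_)
  have h2 := hc.dist_le_mul ω 0
  rw [dist_eq_norm, dist_zero_right] at h2
  calc ‖c ω‖ = ‖c 0 + (c ω - c 0)‖ := by ring_nf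
    _ ≤ ‖c 0‖ + ‖c ω - c 0‖ := norm_add_le _ _
    _ ≤ ‖c 0‖ + K * ‖ω‖ := by gcongr

end RelaxedMOT

end

/-!
Stability of martingale optimal transport under perturbation of the marginals and relaxation of the
martingale constraint.

Duality between `ℓ¹` and `ℓ^∞` turns the martingale constraint into a family of inequalities:
`E‖E[S_{k+1} | ℱ_k] - S_k‖ ≤ ε` holds if and only if
`E[∑ i, g_i(S_1, …, S_k) (S_{k+1} - S_k)_i] ≤ ε` for all functions `g` with values in `[-1, 1]^d`.
All measurable `g` may be used when the constraint is given
(`IsApproxMartingale.integral_test_le`), and continuous `g` suffice to verify it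
(`isApproxMartingale_of_integral_test_le`). The theorem then rests on two facts.

*Transfer.* Let `P` be an `ε`-approximating martingale measure with marginals `μ`, and let `π k` be
couplings of `μ k` and `ν k`. Moving each coordinate `X_k` of a path with law `P` independently by
the conditional law of `π k` gives a path `Y` with marginals `ν`. For a test function `g`, write
`Y_{k+1} - Y_k = (Y_{k+1} - X_{k+1}) + (X_{k+1} - X_k) + (X_k - Y_k)`. The outer terms contribute at
most the costs of `π (k + 1)` and `π k`. In the middle term `g(Y_1, …, Y_k)` may be replaced by its
conditional mean given `X`, which is a function of `X_1, …, X_k` with the same bound, so this term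
is at most `ε` (`exists_approxMartingale_of_couplings`). Expectations of a `K`-Lipschitz function
change by at most `K` times the sum of the costs.

*Compactness.* Convergence of the marginals in the Wasserstein distance bounds the first moments,
which gives tightness, and makes the expectations of `∑ k, ‖S_k‖` converge, so that expectations of
continuous functions of linear growth pass to weak limits (`tendsto_integral_of_linear_growth`).
This applies to Lipschitz rewards and to the continuous test functions above, so weak limits satisfy
the limiting constraint (`mem_approxMartingaleMeasures_of_tendsto`, `exists_tendsto_subseq`).

Compactness for fixed marginals provides optimizers, and lets almost optimal couplings stand in for
optimal ones in the transfer. Weak limits of optimizers are feasible by compactness and optimal by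
transfer (`isOptimizer_of_tendsto`), and the convergence statements follow by passing to
subsequences (`exists_subseq_tendsto_isOptimizer`).
-/

noncomputable section

namespace RelaxedMOT

/-! ### Duality for the norm of a conditional expectation -/

lemma abs_coord_le_norm {d : ℕ} (x : Space d) (i : Fin d) : |x i| ≤ ‖x‖ :=
  PiLp.norm_apply_le x i

/-- The `ℓ^∞`–`ℓ¹` duality bound. -/
lemma sum_mul_coord_le_norm {d : ℕ} {g : Fin d → ℝ} (hg : ∀ i, |g i| ≤ 1) (x : Space d) :
    ∑ i, g i * x i ≤ ‖x‖ := by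
  rw [PiLp.norm_eq_of_L1]
  refine Finset.sum_le_sum fun i _ => ?_
  calc g i * x i ≤ |g i * x i| := le_abs_self _
    _ = |g i| * ‖x i‖ := abs_mul _ _
    _ ≤ 1 * ‖x i‖ := by gcongr; exact hg i
    _ = ‖x i‖ := one_mul _

lemma integrable_coord {α : Type*} [MeasurableSpace α] {P : Measure α} {d : ℕ}
    {X : α → Space d} (hX : Integrable X P) (i : Fin d) : Integrable (fun a => X a i) P :=
  (PiLp.proj 1 (fun _ : Fin d => ℝ) i : Space d →L[ℝ] ℝ).integrable_comp hX

lemma integrable_mul_coord {α E : Type*} [MeasurableSpace α] [MeasurableSpace E] {P : Measure α}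
    {d : ℕ} {ρ : α → E} (hρ : Measurable ρ) {X : α → Space d} (hX : Integrable X P)
    {g : E → Fin d → ℝ} (hg : Measurable g) (hb : ∀ e i, |g e i| ≤ 1) (i : Fin d) :
    Integrable (fun a => g (ρ a) i * X a i) P :=
  (integrable_coord hX i).bdd_mul
    ((measurable_pi_apply i).comp (hg.comp hρ)).aestronglyMeasurable
    (Eventually.of_forall fun a => hb (ρ a) i)

lemma integral_mul_coord_eq_condExp {α E : Type*} [MeasurableSpace α]
    [mE : MeasurableSpace E] {P : Measure α} [IsProbabilityMeasure P] {d : ℕ} {ρ : α → E}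
    (hρ : Measurable ρ) {X : α → Space d} (hX : Integrable X P) {g : E → Fin d → ℝ}
    (hg : Measurable g) (hb : ∀ e i, |g e i| ≤ 1) (i : Fin d) :
    ∫ a, g (ρ a) i * X a i ∂P = ∫ a, g (ρ a) i * P[X | mE.comap ρ] a i ∂P := by
  have hm : mE.comap ρ ≤ (inferInstance : MeasurableSpace α) := hρ.comap_le
  have hgi : StronglyMeasurable[mE.comap ρ] (fun a => g (ρ a) i) :=
    (((measurable_pi_apply i).comp hg).comp (comap_measurable ρ)).stronglyMeasurable
  have h1 := condExp_mul_of_stronglyMeasurable_left (μ := P) hgi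
    (integrable_mul_coord hρ hX hg hb i) (integrable_coord hX i)
  have h2 := (PiLp.proj 1 (fun _ : Fin d => ℝ) i : Space d →L[ℝ] ℝ).comp_condExp_comm
    (m := mE.comap ρ) hX
  rw [← integral_condExp hm]
  refine integral_congr_ae ?_
  filter_upwards [h1, h2] with a h1 h2
  simp only [Function.comp_def, Pi.mul_apply, PiLp.proj_apply] at h1 h2
  rw [h2]
  exact h1

/-- Testing `X` against a `σ(ρ)`-measurable direction bounded by one gives at most the `L¹` norm of
the conditional expectation of `X` given `σ(ρ)`. -/
lemma integral_test_le_integral_norm_condExp {α E : Type*} [MeasurableSpace α]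
    [mE : MeasurableSpace E] {P : Measure α} [IsProbabilityMeasure P] {d : ℕ} {ρ : α → E}
    (hρ : Measurable ρ) {X : α → Space d} (hX : Integrable X P) {g : E → Fin d → ℝ}
    (hg : Measurable g) (hb : ∀ e i, |g e i| ≤ 1) :
    ∫ a, ∑ i, g (ρ a) i * X a i ∂P ≤ ∫ a, ‖P[X | mE.comap ρ] a‖ ∂P := by
  have hY : Integrable (P[X | mE.comap ρ]) P := integrable_condExp
  rw [integral_finsetSum _ fun i _ => integrable_mul_coord hρ hX hg hb i]
  simp_rw [integral_mul_coord_eq_condExp hρ hX hg hb]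
  rw [← integral_finsetSum _ fun i _ => integrable_mul_coord hρ hY hg hb i]
  exact integral_mono (integrable_finsetSum _ fun i _ => integrable_mul_coord hρ hY hg hb i)
    hY.norm fun a => sum_mul_coord_le_norm (hb (ρ a)) _

/-- The `L¹` norm of a conditional expectation is attained by testing against its coordinatewise
sign. -/
lemma exists_test_eq_integral_norm_condExp {α E : Type*} [MeasurableSpace α]
    [mE : MeasurableSpace E] {P : Measure α} [IsProbabilityMeasure P] {d : ℕ} {ρ : α → E}
    (hρ : Measurable ρ) {X : α → Space d} (hX : Integrable X P) :
    ∃ g : E → Fin d → ℝ, Measurable g ∧ (∀ e i, |g e i| ≤ 1) ∧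
      ∫ a, ∑ i, g (ρ a) i * X a i ∂P = ∫ a, ‖P[X | mE.comap ρ] a‖ ∂P := by
  obtain ⟨φ, hφ, hφe⟩ := (stronglyMeasurable_condExp (m := mE.comap ρ) (f := X) (μ := P)
    ).measurable.exists_eq_measurable_comp
  set g : E → Fin d → ℝ := fun e i => if 0 ≤ φ e i then 1 else -1 with hgdef
  have hgm : Measurable g := by
    refine measurable_pi_lambda _ fun i => Measurable.ite ?_ measurable_const measurable_const
    exact measurableSet_le measurable_const
      ((PiLp.proj 1 (fun _ : Fin d => ℝ) i : Space d →L[ℝ] ℝ).continuous.measurable.comp hφ)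
  have hb : ∀ e i, |g e i| ≤ 1 := fun e i => by
    simp only [hgdef]; split_ifs <;> simp
  have hgφ (e : E) : ∑ i, g e i * φ e i = ‖φ e‖ := by
    rw [PiLp.norm_eq_of_L1]
    refine Finset.sum_congr rfl fun i _ => ?_
    simp only [hgdef, Real.norm_eq_abs]
    split_ifs with h
    · rw [one_mul, abs_of_nonneg h]
    · rw [abs_of_neg (not_le.1 h), neg_one_mul]
  refine ⟨g, hgm, hb, ?_⟩
  have hY : Integrable (P[X | mE.comap ρ]) P := integrable_condExp
  rw [integral_finsetSum _ fun i _ => integrable_mul_coord hρ hX hgm hb i]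
  simp_rw [integral_mul_coord_eq_condExp hρ hX hgm hb]
  rw [← integral_finsetSum _ fun i _ => integrable_mul_coord hρ hY hgm hb i]
  refine integral_congr_ae (Eventually.of_forall fun a => ?_)
  simp only [hφe, Function.comp_apply]
  exact hgφ (ρ a)

/-- The metric projection of the real line onto `[-1, 1]`. -/
def clamp (t : ℝ) : ℝ := max (-1) (min 1 t)

lemma abs_clamp_le_one (t : ℝ) : |clamp t| ≤ 1 :=
  abs_le.2 ⟨le_max_left _ _, max_le (by norm_num) (min_le_left _ _)⟩

lemma continuous_clamp : Continuous clamp := by unfold clamp; fun_prop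

lemma abs_sub_clamp_le {s : ℝ} (hs : |s| ≤ 1) (t : ℝ) : |s - clamp t| ≤ |s - t| := by
  have h := abs_le.1 hs
  have hs' : max (-1) (min 1 s) = s := by rw [min_eq_right h.2, max_eq_right h.1]
  calc |s - clamp t| = |max (min 1 s) (-1) - max (min 1 t) (-1)| := by
        rw [clamp, max_comm _ (min 1 t), max_comm (min 1 s), hs']
    _ ≤ |min 1 s - min 1 t| := abs_max_sub_max_le_abs _ _ _
    _ = |min s 1 - min t 1| := by rw [min_comm 1 s, min_comm 1 t]
    _ ≤ |s - t| := by
      refine (abs_min_sub_min_le_max _ _ _ _).trans ?_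
      simp

/-- A bounded measurable function of `ρ` can be replaced by a continuous one with the same bound, at
arbitrarily small cost in the weighted `L¹` norm with weight `‖X‖`. -/
lemma exists_continuous_approx_test {α E : Type*} [MeasurableSpace α] [MeasurableSpace E]
    [TopologicalSpace E] [TopologicalSpace.PseudoMetrizableSpace E] [BorelSpace E] {P : Measure α}
    [IsProbabilityMeasure P] {d : ℕ} {ρ : α → E} (hρ : Measurable ρ) {X : α → Space d}
    (hXm : Measurable X) (hX : Integrable X P) {s : E → ℝ} (hs : Measurable s)
    (hb : ∀ e, |s e| ≤ 1) {δ : ℝ} (hδ : 0 < δ) :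
    ∃ f : E → ℝ, Continuous f ∧ (∀ e, |f e| ≤ 1) ∧
      ∫ a, |s (ρ a) - f (ρ a)| * ‖X a‖ ∂P ≤ δ := by
  set ν : Measure E := (P.withDensity fun a => (‖X a‖₊ : ENNReal)).map ρ with hν
  have hfin : IsFiniteMeasure (P.withDensity fun a => (‖X a‖₊ : ENNReal)) :=
    isFiniteMeasure_withDensity hX.2.ne
  have hνfin : IsFiniteMeasure ν := by rw [hν]; infer_instance
  have hsi : Integrable s ν :=
    (integrable_const (1 : ℝ)).mono' hs.aestronglyMeasurable (Eventually.of_forall hb)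
  obtain ⟨f, hf, hfi⟩ := hsi.exists_boundedContinuous_integral_sub_le hδ
  have hfc : Continuous fun e => clamp (f e) := continuous_clamp.comp f.continuous
  refine ⟨fun e => clamp (f e), hfc, fun e => abs_clamp_le_one _, ?_⟩
  have hfm : Measurable fun e => |s e - clamp (f e)| := by
    have := hfc.measurable
    exact (hs.sub this).abs
  calc ∫ a, |s (ρ a) - clamp (f (ρ a))| * ‖X a‖ ∂P
      = ∫ a, |s (ρ a) - clamp (f (ρ a))| ∂(P.withDensity fun a => (‖X a‖₊ : ENNReal)) := by
        rw [integral_withDensity_eq_integral_smul hXm.nnnorm]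
        refine integral_congr_ae (Eventually.of_forall fun a => ?_)
        simp [NNReal.smul_def, mul_comm]
    _ = ∫ e, |s e - clamp (f e)| ∂ν := by
        rw [hν, integral_map hρ.aemeasurable hfm.aestronglyMeasurable]
    _ ≤ ∫ e, ‖s e - f e‖ ∂ν := by
        refine integral_mono_of_nonneg (Eventually.of_forall fun e => abs_nonneg _)
          (hsi.sub hfi).norm (Eventually.of_forall fun e => abs_sub_clamp_le (hb e) _)
    _ ≤ δ := hf

/-- To bound the `L¹` norm of a conditional expectation given `σ(ρ)` it suffices to test against
continuous functions of `ρ` with values in `[-1, 1]^d`. -/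
lemma integral_norm_condExp_le_of_continuous {α E : Type*} [MeasurableSpace α]
    [mE : MeasurableSpace E] [TopologicalSpace E] [TopologicalSpace.PseudoMetrizableSpace E]
    [BorelSpace E] {P : Measure α} [IsProbabilityMeasure P] {d : ℕ} {ρ : α → E}
    (hρ : Measurable ρ) {X : α → Space d} (hXm : Measurable X) (hX : Integrable X P) {ε : ℝ}
    (h : ∀ g : E → Fin d → ℝ, Continuous g → (∀ e i, |g e i| ≤ 1) →
      ∫ a, ∑ i, g (ρ a) i * X a i ∂P ≤ ε) :
    ∫ a, ‖P[X | mE.comap ρ] a‖ ∂P ≤ ε := by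
  obtain ⟨s, hs, hsb, hse⟩ := exists_test_eq_integral_norm_condExp (P := P) hρ hX
  rw [← hse]
  refine le_of_forall_pos_le_add fun δ hδ => ?_
  -- an error budget per coordinate, with `d + 1` because `d` may vanish
  have hδ' : 0 < δ / (d + 1) := by positivity
  choose f hf hfb hfe using fun i => exists_continuous_approx_test (P := P)
    (s := fun e => s e i) hρ hXm hX ((measurable_pi_apply i).comp hs) (fun e => hsb e i) hδ'
  have hg : Continuous fun e i => f i e := continuous_pi hf
  have hgm : Measurable fun e i => f i e := measurable_pi_lambda _ fun i => (hf i).measurable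
  have hgb : ∀ e i, |f i e| ≤ 1 := fun e i => hfb i e
  have h1 := h _ hg hgb
  have h2 : ∀ i, ∫ a, s (ρ a) i * X a i ∂P ≤ ∫ a, f i (ρ a) * X a i ∂P + δ / (d + 1) := by
    intro i
    have hd : Integrable (fun a => |s (ρ a) i - f i (ρ a)| * ‖X a‖) P := by
      refine hX.norm.bdd_mul (c := 2) ?_ (Eventually.of_forall fun a => ?_)
      · exact (((measurable_pi_apply i).comp (hs.comp hρ)).sub
          ((hf i).measurable.comp hρ)).abs.aestronglyMeasurable
      · rw [Real.norm_eq_abs, abs_abs]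
        have := abs_sub (s (ρ a) i) (f i (ρ a))
        linarith [hsb (ρ a) i, hfb i (ρ a)]
    have hi := integrable_mul_coord hρ hX hs hsb i
    have hj := integrable_mul_coord hρ hX hgm hgb i
    refine le_trans ?_ (add_le_add_right (hfe i) _)
    rw [← integral_add hj hd]
    refine integral_mono hi (hj.add hd) fun a => ?_
    have h3 : (s (ρ a) i - f i (ρ a)) * X a i ≤ |s (ρ a) i - f i (ρ a)| * ‖X a‖ := by
      refine (le_abs_self _).trans ?_
      rw [abs_mul]
      gcongr
      exact abs_coord_le_norm _ _
    simp only
    linarith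
  rw [integral_finsetSum _ fun i _ => integrable_mul_coord hρ hX hs hsb i]
  rw [integral_finsetSum _ fun i _ => integrable_mul_coord hρ hX hgm hgb i] at h1
  calc ∑ i, ∫ a, s (ρ a) i * X a i ∂P
      ≤ ∑ i, (∫ a, f i (ρ a) * X a i ∂P + δ / (d + 1)) := Finset.sum_le_sum fun i _ => h2 i
    _ = ∑ i, ∫ a, f i (ρ a) * X a i ∂P + d * (δ / (d + 1)) := by
      rw [Finset.sum_add_distrib]; simp
    _ ≤ ε + δ := by
      gcongr
      rw [mul_div_assoc', div_le_iff₀ (by positivity)]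
      nlinarith

/-! ### Approximating martingales tested along the past -/

/-- The path up to and including time `k`. -/
def past {N d : ℕ} (k : Fin N) (ω : PathSpace N d) : Set.Iic k → Space d := fun j => ω j

lemma continuous_past {N d : ℕ} (k : Fin N) : Continuous (past (d := d) k) :=
  continuous_pi fun j => continuous_apply (j : Fin N)

lemma measurable_past {N d : ℕ} (k : Fin N) : Measurable (past (d := d) k) :=
  (continuous_past k).measurable

lemma coordFiltration_eq_comap_past {N d : ℕ} (k : Fin N) :
    coordFiltration N d k = MeasurableSpace.comap (past k) inferInstance :=
  Filtration.natural_eq_comap _ _ k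

lemma integrable_eval {N d : ℕ} {P : Measure (PathSpace N d)}
    (hP : Integrable (fun ω : PathSpace N d => ‖ω‖) P) (k : Fin N) :
    Integrable (fun ω : PathSpace N d => ω k) P :=
  hP.mono' (measurable_pi_apply k).aestronglyMeasurable
    (Eventually.of_forall fun ω => norm_le_pi_norm ω k)

/-- The increment of the path after time `k`. -/
def increment {N d : ℕ} (k : Fin N) (hk : (k : ℕ) + 1 < N) (ω : PathSpace N d) : Space d :=
  ω ⟨(k : ℕ) + 1, hk⟩ - ω k

lemma continuous_increment {N d : ℕ} (k : Fin N) (hk : (k : ℕ) + 1 < N) :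
    Continuous (increment (d := d) k hk) :=
  (continuous_apply _).sub (continuous_apply _)

lemma integrable_increment {N d : ℕ} {P : Measure (PathSpace N d)}
    (hP : Integrable (fun ω : PathSpace N d => ‖ω‖) P) (k : Fin N) (hk : (k : ℕ) + 1 < N) :
    Integrable (increment k hk) P :=
  (integrable_eval hP _).sub (integrable_eval hP _)

/-- Since `S_k` is known at time `k`, the martingale defect is the norm of the conditional
expectation of the increment given the past. -/
lemma integral_defect_eq {N d : ℕ} {P : ProbabilityMeasure (PathSpace N d)}
    (hP : Integrable (fun ω : PathSpace N d => ‖ω‖) (P : Measure (PathSpace N d)))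
    (k : Fin N) (hk : (k : ℕ) + 1 < N) :
    ∫ ω, ‖((P : Measure (PathSpace N d))[fun ω' : PathSpace N d => ω' ⟨(k : ℕ) + 1, hk⟩ |
        coordFiltration N d k]) ω - ω k‖ ∂(P : Measure (PathSpace N d)) =
    ∫ ω, ‖((P : Measure (PathSpace N d))[increment k hk |
        MeasurableSpace.comap (past k) inferInstance]) ω‖ ∂(P : Measure (PathSpace N d)) := by
  rw [coordFiltration_eq_comap_past]
  have hm : MeasurableSpace.comap (past (d := d) k) inferInstance ≤
      (inferInstance : MeasurableSpace (PathSpace N d)) := (measurable_past k).comap_le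
  have h1 := condExp_sub (integrable_eval hP ⟨(k : ℕ) + 1, hk⟩) (integrable_eval hP k)
    (MeasurableSpace.comap (past (d := d) k) inferInstance)
  have hk' : StronglyMeasurable[MeasurableSpace.comap (past (d := d) k) inferInstance]
      (fun ω : PathSpace N d => ω k) :=
    ((measurable_pi_apply (⟨k, Set.mem_Iic.2 le_rfl⟩ : Set.Iic k)).comp
      (comap_measurable (past (d := d) k))).stronglyMeasurable
  rw [condExp_of_stronglyMeasurable hm hk' (integrable_eval hP k)] at h1
  refine integral_congr_ae ?_
  filter_upwards [h1] with ω h1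
  exact congrArg norm h1.symm

lemma IsApproxMartingale.integral_test_le {N d : ℕ} {ε : ℝ} {P : ProbabilityMeasure (PathSpace N d)}
    (h : IsApproxMartingale ε P)
    (hP : Integrable (fun ω : PathSpace N d => ‖ω‖) (P : Measure (PathSpace N d)))
    (k : Fin N) (hk : (k : ℕ) + 1 < N) {g : (Set.Iic k → Space d) → Fin d → ℝ} (hg : Measurable g)
    (hb : ∀ e i, |g e i| ≤ 1) :
    ∫ ω, ∑ i, g (past k ω) i * increment k hk ω i ∂(P : Measure (PathSpace N d)) ≤ ε :=
  (integral_test_le_integral_norm_condExp (measurable_past k) (integrable_increment hP k hk)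
    hg hb).trans ((integral_defect_eq hP k hk).symm.le.trans (h k hk))

lemma isApproxMartingale_of_integral_test_le {N d : ℕ} {ε : ℝ}
    {P : ProbabilityMeasure (PathSpace N d)}
    (hP : Integrable (fun ω : PathSpace N d => ‖ω‖) (P : Measure (PathSpace N d)))
    (h : ∀ (k : Fin N) (hk : (k : ℕ) + 1 < N) (g : (Set.Iic k → Space d) → Fin d → ℝ),
      Continuous g → (∀ e i, |g e i| ≤ 1) →
      ∫ ω, ∑ i, g (past k ω) i * increment k hk ω i ∂(P : Measure (PathSpace N d)) ≤ ε) :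
    IsApproxMartingale ε P := fun k hk =>
  (integral_defect_eq hP k hk).le.trans
    (integral_norm_condExp_le_of_continuous (measurable_past k)
      (continuous_increment k hk).measurable (integrable_increment hP k hk) (h k hk))

/-! ### Products of kernels acting coordinatewise -/

/-- The kernel that moves the coordinates of `x` independently, the `i`-th one by `κ i`. -/
def piKernel {ι α β : Type*} [Fintype ι] [MeasurableSpace α] [MeasurableSpace β]
    (κ : ι → Kernel α β) [∀ i, IsMarkovKernel (κ i)] : Kernel (ι → α) (ι → β) where
  toFun x := Measure.pi fun i => κ i (x i)
  measurable' := by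
    refine Measurable.measure_of_isPiSystem_of_isProbabilityMeasure generateFrom_pi.symm
      (isPiSystem_pi) ?_
    rintro _ ⟨s, hs, rfl⟩
    simp only [Measure.pi_pi]
    exact Finset.measurable_fun_prod _ fun i _ =>
      ((κ i).measurable_coe (hs i (Set.mem_univ i))).comp (measurable_pi_apply i)

lemma piKernel_apply {ι α β : Type*} [Fintype ι] [MeasurableSpace α] [MeasurableSpace β]
    (κ : ι → Kernel α β) [∀ i, IsMarkovKernel (κ i)] (x : ι → α) :
    piKernel κ x = Measure.pi fun i => κ i (x i) := rfl

instance {ι α β : Type*} [Fintype ι] [MeasurableSpace α] [MeasurableSpace β]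
    (κ : ι → Kernel α β) [∀ i, IsMarkovKernel (κ i)] : IsMarkovKernel (piKernel κ) :=
  ⟨fun x => by rw [piKernel_apply]; infer_instance⟩

/-- Restricting a product of probability measures to a subfamily of the coordinates gives the
product over the subfamily. -/
lemma pi_map_subtype {ι β : Type*} [Fintype ι] [MeasurableSpace β] (p : ι → Prop)
    [Fintype {i // p i}] (m : ι → Measure β) [∀ i, IsProbabilityMeasure (m i)] :
    (Measure.pi m).map (fun (y : ι → β) (j : {i // p i}) => y j) =
      Measure.pi fun j : {i // p i} => m j := by
  classical
  symm
  refine Measure.pi_eq fun s hs => ?_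
  have hm : Measurable fun (y : ι → β) (j : {i // p i}) => y j := by fun_prop
  rw [Measure.map_apply hm (MeasurableSet.univ_pi hs)]
  have hset : (fun (y : ι → β) (j : {i // p i}) => y j) ⁻¹' Set.univ.pi s =
      Set.univ.pi fun i => if h : p i then s ⟨i, h⟩ else Set.univ := by
    ext y
    simp only [Set.mem_preimage, Set.mem_pi, Set.mem_univ, true_imp_iff, Subtype.forall]
    refine forall_congr' fun i => ?_
    by_cases h : p i <;> simp [h]
  rw [hset, Measure.pi_pi]
  rw [← Fintype.prod_subtype_mul_prod_subtype p]
  have h1 : ∀ j : {i // p i}, m j (if h : p j then s ⟨j, h⟩ else Set.univ) = m j (s j) :=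
    fun j => by rw [dif_pos j.2]
  have h2 : ∀ j : {i // ¬ p i}, m j (if h : p j then s ⟨j, h⟩ else Set.univ) = 1 :=
    fun j => by rw [dif_neg j.2, measure_univ]
  rw [Finset.prod_congr rfl fun j _ => h1 j, Finset.prod_congr rfl fun j _ => h2 j,
    Finset.prod_const_one, mul_one]
  refine Finset.prod_congr (by ext; simp) fun j _ => rfl

/-- Under the coordinatewise kernel, the law of the new past depends on the old past only. -/
lemma piKernel_map_past {N d : ℕ} (κ : Fin N → Kernel (Space d) (Space d))
    [∀ i, IsMarkovKernel (κ i)] (k : Fin N) (x : PathSpace N d) :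
    (piKernel κ x).map (past k) = piKernel (fun j : Set.Iic k => κ j) (past k x) :=
  pi_map_subtype (fun i => i ∈ Set.Iic k) fun i => κ i (x i)

/-- If `x` has law `P` and `y` is obtained from it by the coordinatewise kernel, then the joint law
of `x k` and `y k` is given by the `k`-th marginal of `P` and the kernel `κ k`. -/
lemma compProd_piKernel_map_eval {ι α β : Type*} [Fintype ι] [MeasurableSpace α]
    [MeasurableSpace β] (κ : ι → Kernel α β) [∀ i, IsMarkovKernel (κ i)] (P : Measure (ι → α))
    [IsProbabilityMeasure P] (k : ι) :
    (P ⊗ₘ piKernel κ).map (fun z => (z.1 k, z.2 k)) = P.map (fun x => x k) ⊗ₘ κ k := by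
  have hm : Measurable fun z : (ι → α) × (ι → β) => (z.1 k, z.2 k) := by fun_prop
  have hprob : IsProbabilityMeasure (P.map fun x => x k) :=
    Measure.isProbabilityMeasure_map (measurable_pi_apply k).aemeasurable
  ext s hs
  rw [Measure.map_apply hm hs, Measure.compProd_apply (hm hs), Measure.compProd_apply hs,
    lintegral_map (Kernel.measurable_kernel_prodMk_left hs) (measurable_pi_apply k)]
  refine lintegral_congr fun x => ?_
  have hs' : MeasurableSet (Prod.mk (x k) ⁻¹' s) := measurable_prodMk_left hs
  exact (measurePreserving_eval (fun i => κ i (x i)) k).measure_preimage hs'.nullMeasurableSet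

/-! ### Marginals and first moments -/

lemma norm_path_le_sum {N d : ℕ} (ω : PathSpace N d) : ‖ω‖ ≤ ∑ k, ‖ω k‖ :=
  (pi_norm_le_iff_of_nonneg (Finset.sum_nonneg fun _ _ => norm_nonneg _)).2 fun k =>
    Finset.single_le_sum (f := fun k => ‖ω k‖) (fun _ _ => norm_nonneg _) (Finset.mem_univ k)

lemma integrable_norm_eval_of_map_eq {N d : ℕ} {P : Measure (PathSpace N d)}
    {μ : FiniteMomentMeasure (Space d)} {k : Fin N} (h : P.map (fun ω => ω k) = μ.law) :
    Integrable (fun ω : PathSpace N d => ‖ω k‖) P := by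
  have h1 := μ.2
  change Integrable _ μ.law at h1
  rw [← h] at h1
  exact h1.comp_measurable (measurable_pi_apply k)

lemma mem_transportPlans_of_map_eq {N d : ℕ} {P : ProbabilityMeasure (PathSpace N d)}
    {μ : Fin N → FiniteMomentMeasure (Space d)}
    (h : ∀ k, (P : Measure (PathSpace N d)).map (fun ω => ω k) = (μ k).law) :
    P ∈ transportPlans μ :=
  ⟨(integrable_finsetSum Finset.univ fun k _ => integrable_norm_eval_of_map_eq (h k)).mono'
    continuous_norm.aestronglyMeasurable
    (Eventually.of_forall fun ω => by simpa using norm_path_le_sum ω), h⟩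

lemma integral_norm_eval {N d : ℕ} {P : ProbabilityMeasure (PathSpace N d)}
    {μ : Fin N → FiniteMomentMeasure (Space d)} (hP : P ∈ transportPlans μ) (k : Fin N) :
    ∫ ω, ‖ω k‖ ∂(P : Measure (PathSpace N d)) = ∫ x, ‖x‖ ∂(μ k).law := by
  rw [← hP.2 k, integral_map (measurable_pi_apply k).aemeasurable
    continuous_norm.aestronglyMeasurable]

lemma integrable_norm_sub_of_mem_couplings {d : ℕ} {μ ν : FiniteMomentMeasure (Space d)}
    {π : ProbabilityMeasure (Space d × Space d)} (hπ : π ∈ couplings μ ν) :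
    Integrable (fun z : Space d × Space d => z.1 - z.2) (π : Measure (Space d × Space d)) := by
  have h1 : Integrable (fun x : Space d => x) μ.law :=
    (integrable_norm_iff continuous_id.aestronglyMeasurable).1 μ.2
  have h2 : Integrable (fun x : Space d => x) ν.law :=
    (integrable_norm_iff continuous_id.aestronglyMeasurable).1 ν.2
  rw [← hπ.1] at h1
  rw [← hπ.2] at h2
  exact (h1.comp_measurable measurable_fst).sub (h2.comp_measurable measurable_snd)

lemma couplings_nonempty {d : ℕ} (μ ν : FiniteMomentMeasure (Space d)) :
    (couplings μ ν).Nonempty :=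
  ⟨⟨μ.law.prod ν.law, inferInstance⟩,
    (Measure.fst_prod : (μ.law.prod ν.law).fst = _),
    (Measure.snd_prod : (μ.law.prod ν.law).snd = _)⟩

lemma wasserstein_nonneg {d : ℕ} (μ ν : FiniteMomentMeasure (Space d)) : 0 ≤ wasserstein μ ν :=
  Real.iInf_nonneg fun _ => integral_nonneg fun _ => norm_nonneg _

lemma exists_coupling_lt {d : ℕ} (μ ν : FiniteMomentMeasure (Space d)) {δ : ℝ} (hδ : 0 < δ) :
    ∃ π ∈ couplings μ ν,
      ∫ z, ‖z.1 - z.2‖ ∂(π : Measure (Space d × Space d)) < wasserstein μ ν + δ := by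
  have : Nonempty (couplings μ ν) := (couplings_nonempty μ ν).to_subtype
  obtain ⟨π, hπ⟩ := exists_lt_of_ciInf_lt (lt_add_of_pos_right (wasserstein μ ν) hδ)
  exact ⟨π.1, π.2, hπ⟩

lemma wasserstein_comm {d : ℕ} (μ ν : FiniteMomentMeasure (Space d)) :
    wasserstein μ ν = wasserstein ν μ := by
  have key (μ ν : FiniteMomentMeasure (Space d)) : wasserstein μ ν ≤ wasserstein ν μ := by
    refine le_of_forall_pos_le_add fun δ hδ => ?_
    obtain ⟨π, hπ, hlt⟩ := exists_coupling_lt ν μ hδ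
    have hs : (⟨(π : Measure (Space d × Space d)).map Prod.swap,
        Measure.isProbabilityMeasure_map measurable_swap.aemeasurable⟩ :
        ProbabilityMeasure (Space d × Space d)) ∈ couplings μ ν := by
      constructor
      · exact (Measure.map_map measurable_fst measurable_swap).trans hπ.2
      · exact (Measure.map_map measurable_snd measurable_swap).trans hπ.1
    refine le_trans (ciInf_le ⟨0, ?_⟩ ⟨_, hs⟩) (le_trans (le_of_eq ?_) hlt.le)
    · rintro _ ⟨π, rfl⟩
      exact integral_nonneg fun _ => norm_nonneg _
    · refine (integral_map measurable_swap.aemeasurable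
        (by fun_prop)).trans ?_
      exact integral_congr_ae (Eventually.of_forall fun z => norm_sub_rev _ _)
  exact le_antisymm (key μ ν) (key ν μ)

lemma wassersteinSum_comm {N d : ℕ} (μ ν : Fin N → FiniteMomentMeasure (Space d)) :
    wassersteinSum μ ν = wassersteinSum ν μ :=
  Finset.sum_congr rfl fun k _ => wasserstein_comm (μ k) (ν k)

lemma wassersteinSum_self {N d : ℕ} (μ : Fin N → FiniteMomentMeasure (Space d)) :
    wassersteinSum μ μ = 0 := by
  refine Finset.sum_eq_zero fun k _ => le_antisymm ?_ (wasserstein_nonneg _ _)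
  have hs : (⟨(μ k).law.map (fun x => (x, x)),
      Measure.isProbabilityMeasure_map (by fun_prop)⟩ :
      ProbabilityMeasure (Space d × Space d)) ∈ couplings (μ k) (μ k) := by
    constructor
    · exact (Measure.map_map measurable_fst (by fun_prop)).trans Measure.map_id
    · exact (Measure.map_map measurable_snd (by fun_prop)).trans Measure.map_id
  refine le_trans (ciInf_le ⟨0, ?_⟩ ⟨_, hs⟩) (le_of_eq ?_)
  · rintro _ ⟨π, rfl⟩
    exact integral_nonneg fun _ => norm_nonneg _
  · refine (integral_map (by fun_prop) (by fun_prop)).trans ?_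
    simp

/-- The easy half of Kantorovich–Rubinstein duality. -/
lemma abs_integral_sub_le_wasserstein {d : ℕ} (μ ν : FiniteMomentMeasure (Space d))
    {f : Space d → ℝ} {L : NNReal} (hf : LipschitzWith L f) :
    |∫ x, f x ∂μ.law - ∫ x, f x ∂ν.law| ≤ L * wasserstein μ ν := by
  have hint (μ : FiniteMomentMeasure (Space d)) : Integrable f μ.law := by
    refine ((integrable_const ‖f 0‖).add (μ.2.const_mul (L : ℝ))).mono'
      hf.continuous.aestronglyMeasurable (Eventually.of_forall fun x => ?_)
    have h := hf.norm_sub_le x 0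
    rw [sub_zero] at h
    have := norm_le_norm_add_norm_sub' (f x) (f 0)
    simp only [Pi.add_apply]
    linarith
  rw [wasserstein, Real.mul_iInf_of_nonneg L.coe_nonneg]
  have : Nonempty (couplings μ ν) := (couplings_nonempty μ ν).to_subtype
  refine le_ciInf fun π => ?_
  have h1 := hint μ
  have h2 := hint ν
  rw [← π.2.1] at h1 ⊢
  rw [← π.2.2] at h2 ⊢
  have h1' : Integrable (fun z : Space d × Space d => f z.1) (π.1 : Measure (Space d × Space d)) :=
    h1.comp_measurable measurable_fst
  have h2' : Integrable (fun z : Space d × Space d => f z.2) (π.1 : Measure (Space d × Space d)) :=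
    h2.comp_measurable measurable_snd
  rw [integral_map measurable_fst.aemeasurable hf.continuous.aestronglyMeasurable,
    integral_map measurable_snd.aemeasurable hf.continuous.aestronglyMeasurable,
    ← integral_sub h1' h2', ← integral_const_mul]
  refine abs_integral_le_integral_abs.trans (integral_mono_of_nonneg
    (Eventually.of_forall fun _ => abs_nonneg _)
    ((integrable_norm_sub_of_mem_couplings π.2).norm.const_mul _)
    (Eventually.of_forall fun z => ?_))
  exact hf.norm_sub_le z.1 z.2

/-! ### Transfer of approximating martingales along couplings of the marginals -/

/-- Moving the marginals of an approximating martingale measure `P` along couplings `π k` of `μ k`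
and `ν k`: each coordinate of a path with law `P` is moved independently by the conditional law of
`π k`. Given the original path, the past of the new one depends on the past of the original one
only, so the martingale defect grows by at most the transport costs at two successive times. -/
lemma exists_approxMartingale_of_couplings {N d : ℕ} {ε : ℝ}
    {μ ν : Fin N → FiniteMomentMeasure (Space d)} {P : ProbabilityMeasure (PathSpace N d)}
    (hP : P ∈ approxMartingaleMeasures ε μ)
    (π : Fin N → ProbabilityMeasure (Space d × Space d)) (hπ : ∀ k, π k ∈ couplings (μ k) (ν k)) :
    ∃ P' ∈ approxMartingaleMeasures
        (ε + ∑ k, ∫ z, ‖z.1 - z.2‖ ∂(π k : Measure (Space d × Space d))) ν,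
      ∀ (c : PathSpace N d → ℝ) (K : NNReal), LipschitzWith K c →
        ∫ ω, c ω ∂(P : Measure (PathSpace N d)) ≤ ∫ ω, c ω ∂(P' : Measure (PathSpace N d)) +
          K * ∑ k, ∫ z, ‖z.1 - z.2‖ ∂(π k : Measure (Space d × Space d)) := by
  set κ : Fin N → Kernel (Space d) (Space d) :=
    fun k => (π k : Measure (Space d × Space d)).condKernel with hκ
  have hκM : ∀ k, IsMarkovKernel (κ k) := fun k => by rw [hκ]; infer_instance
  set J : Measure (PathSpace N d × PathSpace N d) :=
    (P : Measure (PathSpace N d)) ⊗ₘ piKernel κ with hJ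
  -- the joint law of the `k`-th coordinates of the old and the new path is `π k`
  have hJπ (k : Fin N) : J.map (fun z => (z.1 k, z.2 k)) = π k := by
    rw [hJ, compProd_piKernel_map_eval, hP.1.2 k, ← (hπ k).1]
    exact (π k : Measure (Space d × Space d)).disintegrate _
  have hmk (k : Fin N) : Measurable fun z : PathSpace N d × PathSpace N d => (z.1 k, z.2 k) := by
    fun_prop
  have hfst : J.map Prod.fst = (P : Measure (PathSpace N d)) :=
    Measure.fst_compProd _ _
  set cost : Fin N → ℝ := fun k => ∫ z, ‖z.1 - z.2‖ ∂(π k : Measure (Space d × Space d))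
    with hcost
  have hdiff (k : Fin N) : Integrable (fun z : PathSpace N d × PathSpace N d =>
      ‖z.1 k - z.2 k‖) J := by
    have h := (integrable_norm_sub_of_mem_couplings (hπ k)).norm
    rw [← hJπ k] at h
    exact h.comp_measurable (hmk k)
  have hdiffc (k : Fin N) : ∫ z, ‖z.1 k - z.2 k‖ ∂J = cost k := by
    simp only [hcost]
    rw [← hJπ k, integral_map (hmk k).aemeasurable (by fun_prop)]
  have hcost0 (k : Fin N) : 0 ≤ cost k := integral_nonneg fun _ => norm_nonneg _
  set P' : ProbabilityMeasure (PathSpace N d) :=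
    ⟨J.map Prod.snd, Measure.isProbabilityMeasure_map measurable_snd.aemeasurable⟩ with hP'
  have hP'c : (P' : Measure (PathSpace N d)) = J.map Prod.snd := rfl
  have hP'ν : P' ∈ transportPlans ν := by
    refine mem_transportPlans_of_map_eq fun k => ?_
    rw [hP'c, Measure.map_map (measurable_pi_apply k) measurable_snd, ← (hπ k).2, ← hJπ k,
      Measure.map_map measurable_snd (hmk k)]
    rfl
  refine ⟨P', ⟨hP'ν, ?_⟩, fun c K hc => ?_⟩
  · refine isApproxMartingale_of_integral_test_le hP'ν.1 fun k hk g hg hb => ?_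
    have hgm := hg.measurable
    have hgi (i : Fin d) : Measurable fun v => g v i := (measurable_pi_apply i).comp hgm
    set k' : Fin N := ⟨(k : ℕ) + 1, hk⟩ with hk'
    -- the conditional mean of the test function given the old path
    set G : (Set.Iic k → Space d) → Fin d → ℝ :=
      fun u i => ∫ v, g v i ∂(piKernel (fun j : Set.Iic k => κ j) u) with hG
    have hGm : Measurable G := by
      refine measurable_pi_lambda _ fun i => ?_
      exact (hgi i).stronglyMeasurable.integral_kernel.measurable
    have hGb : ∀ u i, |G u i| ≤ 1 := fun u i => by
      have := norm_integral_le_of_norm_le_const (μ := piKernel (fun j : Set.Iic k => κ j) u)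
        (Eventually.of_forall fun v => (Real.norm_eq_abs _).trans_le (hb v i))
      simpa using this
    have hincJ : Integrable (fun z : PathSpace N d × PathSpace N d => increment k hk z.1) J := by
      have h := integrable_increment hP.1.1 k hk
      rw [← hfst] at h
      exact h.comp_measurable measurable_fst
    have hincJ' : Integrable (fun z : PathSpace N d × PathSpace N d => increment k hk z.2) J := by
      have h := integrable_increment hP'ν.1 k hk
      rw [hP'c] at h
      exact h.comp_measurable measurable_snd
    have hpast2 : Measurable fun z : PathSpace N d × PathSpace N d => past k z.2 :=
      (measurable_past k).comp measurable_snd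
    -- integrating out the new path replaces `g` by `G` and leaves an expectation under `P`
    have hmid : ∫ z, ∑ i, g (past k z.2) i * increment k hk z.1 i ∂J ≤ ε := by
      have hint (i : Fin d) := integrable_mul_coord hpast2 hincJ hgm hb i
      have heq (i : Fin d) : ∫ z, g (past k z.2) i * increment k hk z.1 i ∂J =
          ∫ x, G (past k x) i * increment k hk x i ∂(P : Measure (PathSpace N d)) := by
        rw [hJ, Measure.integral_compProd (hint i)]
        refine integral_congr_ae (Eventually.of_forall fun x => ?_)
        simp only [hG]
        rw [integral_mul_const, ← piKernel_map_past, integral_map (measurable_past k).aemeasurable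
          (hgi i).aestronglyMeasurable]
      rw [integral_finsetSum _ fun i _ => hint i]
      simp_rw [heq]
      rw [← integral_finsetSum _ fun i _ =>
        integrable_mul_coord (measurable_past k) (integrable_increment hP.1.1 k hk) hGm hGb i]
      exact hP.2.integral_test_le hP.1.1 k hk hGm hGb
    have hsum (X : PathSpace N d × PathSpace N d → Space d) (hX : Integrable X J) :
        Integrable (fun z => ∑ i, g (past k z.2) i * X z i) J :=
      integrable_finsetSum _ fun i _ => integrable_mul_coord hpast2 hX hgm hb i
    have hdd : Integrable (fun z => ‖z.1 k' - z.2 k'‖ + ‖z.1 k - z.2 k‖) J :=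
      (hdiff k').add (hdiff k)
    -- the two costs belong to different times, so together they are bounded by the full sum
    have hcosts : cost k' + cost k ≤ ∑ j, cost j := by
      have hne : k' ≠ k := by simp [hk', Fin.ext_iff]
      rw [← Finset.sum_pair hne]
      exact Finset.sum_le_sum_of_subset_of_nonneg (Finset.subset_univ _) fun j _ _ => hcost0 j
    calc ∫ ω, ∑ i, g (past k ω) i * increment k hk ω i ∂(P' : Measure (PathSpace N d))
        = ∫ z, ∑ i, g (past k z.2) i * increment k hk z.2 i ∂J := by
          rw [hP'c, integral_map measurable_snd.aemeasurable]
          refine Measurable.aestronglyMeasurable (Finset.measurable_fun_sum _ fun i _ => ?_)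
          refine ((hgi i).comp (measurable_past k)).mul ?_
          exact ((PiLp.proj 1 (fun _ : Fin d => ℝ) i : Space d →L[ℝ] ℝ).continuous.comp
            (continuous_increment k hk)).measurable
      _ ≤ ∫ z, (∑ i, g (past k z.2) i * increment k hk z.1 i +
            (‖z.1 k' - z.2 k'‖ + ‖z.1 k - z.2 k‖)) ∂J := by
          refine integral_mono (hsum _ hincJ')
            ((hsum _ hincJ).add hdd) fun z => ?_
          have h1 := sum_mul_coord_le_norm (hb (past k z.2))
            (increment k hk z.2 - increment k hk z.1)
          have h2 : ‖increment k hk z.2 - increment k hk z.1‖ ≤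
              ‖z.1 k' - z.2 k'‖ + ‖z.1 k - z.2 k‖ := by
            have h3 : increment k hk z.2 - increment k hk z.1 =
                (z.1 k - z.2 k) - (z.1 k' - z.2 k') := by
              simp only [increment, hk']; abel
            rw [h3, add_comm]
            exact norm_sub_le _ _
          simp only [PiLp.sub_apply, mul_sub, Finset.sum_sub_distrib] at h1
          simp only
          linarith
      _ = ∫ z, ∑ i, g (past k z.2) i * increment k hk z.1 i ∂J + (cost k' + cost k) := by
          rw [integral_add (hsum _ hincJ) hdd,
            integral_add (hdiff k') (hdiff k), hdiffc, hdiffc]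
      _ ≤ ε + ∑ j, cost j := add_le_add hmid hcosts
  · have hc1 : Integrable (fun z : PathSpace N d × PathSpace N d => c z.1) J := by
      have h := integrable_reward hc hP.1
      rw [← hfst] at h
      exact h.comp_measurable measurable_fst
    have hc2 : Integrable (fun z : PathSpace N d × PathSpace N d => c z.2) J := by
      have h := integrable_reward hc hP'ν
      rw [hP'c] at h
      exact h.comp_measurable measurable_snd
    have hS : Integrable (fun z : PathSpace N d × PathSpace N d =>
        (K : ℝ) * ∑ k, ‖z.1 k - z.2 k‖) J :=
      (integrable_finsetSum _ fun k _ => hdiff k).const_mul _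
    calc ∫ ω, c ω ∂(P : Measure (PathSpace N d)) = ∫ z, c z.1 ∂J := by
          rw [← hfst, integral_map measurable_fst.aemeasurable
            hc.continuous.aestronglyMeasurable]
      _ ≤ ∫ z, (c z.2 + K * ∑ k, ‖z.1 k - z.2 k‖) ∂J := by
          refine integral_mono hc1 (hc2.add hS) fun z => ?_
          have h1 := (le_abs_self _).trans (hc.norm_sub_le z.1 z.2)
          have h2 : (K : ℝ) * ‖z.1 - z.2‖ ≤ K * ∑ k, ‖z.1 k - z.2 k‖ :=
            mul_le_mul_of_nonneg_left (norm_path_le_sum (z.1 - z.2)) K.coe_nonneg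
          simp only
          linarith
      _ = ∫ z, c z.2 ∂J + K * ∑ k, cost k := by
          rw [integral_add hc2 hS, integral_const_mul, integral_finsetSum _ fun k _ => hdiff k]
          simp_rw [hdiffc]
      _ = _ := by
          rw [hP'c, integral_map measurable_snd.aemeasurable hc.continuous.aestronglyMeasurable]

/-- Moving an approximating martingale measure to other marginals, at the cost of the Wasserstein
distance up to an arbitrarily small error. -/
lemma exists_approxMartingale_add {N d : ℕ} {ε : ℝ}
    {μ ν : Fin N → FiniteMomentMeasure (Space d)} {P : ProbabilityMeasure (PathSpace N d)}
    (hP : P ∈ approxMartingaleMeasures ε μ) {δ : ℝ} (hδ : 0 < δ) :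
    ∃ P' ∈ approxMartingaleMeasures (ε + (wassersteinSum μ ν + δ)) ν,
      ∀ (c : PathSpace N d → ℝ) (K : NNReal), LipschitzWith K c →
        ∫ ω, c ω ∂(P : Measure (PathSpace N d)) ≤ ∫ ω, c ω ∂(P' : Measure (PathSpace N d)) +
          K * (wassersteinSum μ ν + δ) := by
  have hδ' : 0 < δ / (N + 1) := by positivity
  choose π hπ hlt using fun k => exists_coupling_lt (μ k) (ν k) hδ'
  obtain ⟨P', hP', h⟩ := exists_approxMartingale_of_couplings hP π hπ
  have hle : ∑ k, ∫ z, ‖z.1 - z.2‖ ∂(π k : Measure (Space d × Space d)) ≤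
      wassersteinSum μ ν + δ := by
    refine (Finset.sum_le_sum fun k _ => (hlt k).le).trans ?_
    rw [Finset.sum_add_distrib, wassersteinSum]
    gcongr
    simp only [Finset.sum_const, Finset.card_univ, Fintype.card_fin, nsmul_eq_mul]
    rw [mul_div_assoc', div_le_iff₀ (by positivity)]
    nlinarith
  exact ⟨P', ⟨hP'.1, fun k hk => (hP'.2 k hk).trans (by gcongr)⟩, fun c K hc =>
    (h c K hc).trans (by gcongr)⟩

/-! ### Weak limits and expectations of functions of linear growth -/

/-- The expectation of a nonnegative continuous function is lower semicontinuous along weak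
convergence. -/
lemma eventually_lt_integral_of_tendsto {Ω : Type*} [MeasurableSpace Ω] [TopologicalSpace Ω]
    [OpensMeasurableSpace Ω] [HasOuterApproxClosed Ω] {Ps : ℕ → ProbabilityMeasure Ω}
    {P : ProbabilityMeasure Ω} (h : Tendsto Ps atTop (𝓝 P)) {f : Ω → ℝ} (hf : Continuous f)
    (hf0 : 0 ≤ f) (hfi : ∀ n, Integrable f (Ps n : Measure Ω)) (hfP : Integrable f (P : Measure Ω))
    {b : ℝ} (hb : b < ∫ ω, f ω ∂(P : Measure Ω)) :
    ∀ᶠ n in atTop, b < ∫ ω, f ω ∂(Ps n : Measure Ω) := by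
  rcases lt_or_ge b 0 with hb0 | hb0
  · exact Eventually.of_forall fun n => hb0.trans_le (integral_nonneg hf0)
  have h1 := lintegral_le_liminf_lintegral_of_forall_isOpen_measure_le_liminf_measure
    (μ := (P : Measure Ω)) (μs := fun n => (Ps n : Measure Ω)) hf hf0
    fun G hG => ProbabilityMeasure.le_liminf_measure_open_of_tendsto h hG
  rw [← ofReal_integral_eq_lintegral_ofReal hfP (Eventually.of_forall hf0)] at h1
  have h2 : ENNReal.ofReal b < liminf (fun n => ∫⁻ ω, ENNReal.ofReal (f ω) ∂(Ps n : Measure Ω))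
      atTop := ((ENNReal.ofReal_lt_ofReal_iff (hb0.trans_lt hb)).2 hb).trans_le h1
  filter_upwards [eventually_lt_of_lt_liminf h2] with n hn
  rw [← ofReal_integral_eq_lintegral_ofReal (hfi n) (Eventually.of_forall hf0)] at hn
  exact (ENNReal.ofReal_lt_ofReal_iff_of_nonneg hb0).1 hn

/-- Weak convergence passes to the expectation of a continuous function which is dominated by a
continuous function whose expectations converge: the expectations of `g + c` and `g - c` are lower
semicontinuous. -/
lemma tendsto_integral_of_dominated {Ω : Type*} [MeasurableSpace Ω] [TopologicalSpace Ω]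
    [OpensMeasurableSpace Ω] [HasOuterApproxClosed Ω] {Ps : ℕ → ProbabilityMeasure Ω}
    {P : ProbabilityMeasure Ω} (h : Tendsto Ps atTop (𝓝 P)) {c g : Ω → ℝ} (hc : Continuous c)
    (hg : Continuous g) (hcg : ∀ ω, |c ω| ≤ g ω) (hgi : ∀ n, Integrable g (Ps n : Measure Ω))
    (hgP : Integrable g (P : Measure Ω))
    (hgt : Tendsto (fun n => ∫ ω, g ω ∂(Ps n : Measure Ω)) atTop (𝓝 (∫ ω, g ω ∂(P : Measure Ω)))) :
    Tendsto (fun n => ∫ ω, c ω ∂(Ps n : Measure Ω)) atTop (𝓝 (∫ ω, c ω ∂(P : Measure Ω))) := by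
  have hint (Q : Measure Ω) (hQ : Integrable g Q) : Integrable c Q :=
    hQ.mono' hc.measurable.aestronglyMeasurable (Eventually.of_forall hcg)
  have hci := fun n => hint _ (hgi n)
  have hcP := hint _ hgP
  rw [Metric.tendsto_atTop'] at hgt ⊢
  intro δ hδ
  have hplus := eventually_lt_integral_of_tendsto h (f := fun ω => g ω + c ω) (hg.add hc)
    (fun ω => by have := (abs_le.1 (hcg ω)).1; simp only [Pi.zero_apply]; linarith)
    (fun n => (hgi n).add (hci n)) (hgP.add hcP) (sub_lt_self _ (half_pos hδ))
  have hminus := eventually_lt_integral_of_tendsto h (f := fun ω => g ω - c ω) (hg.sub hc)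
    (fun ω => by have := (abs_le.1 (hcg ω)).2; simp only [Pi.zero_apply]; linarith)
    (fun n => (hgi n).sub (hci n)) (hgP.sub hcP) (sub_lt_self _ (half_pos hδ))
  obtain ⟨n₁, h₁⟩ := hgt (δ / 2) (half_pos hδ)
  obtain ⟨n₂, h₂⟩ := eventually_atTop.1 (hplus.and hminus)
  refine ⟨max n₁ n₂, fun n hn => ?_⟩
  have e1 := h₁ n ((le_max_left _ _).trans_lt hn)
  obtain ⟨e2, e3⟩ := h₂ n ((le_max_right _ _).trans hn.le)
  rw [integral_add hgP hcP, integral_add (hgi n) (hci n)] at e2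
  rw [integral_sub hgP hcP, integral_sub (hgi n) (hci n)] at e3
  rw [Real.dist_eq, abs_lt] at e1 ⊢
  constructor <;> linarith [e1.1, e1.2]

/-! ### Compactness of the approximating martingale measures -/

lemma tendsto_wasserstein_of_tendsto_sum {N d : ℕ} {μ : Fin N → FiniteMomentMeasure (Space d)}
    {μs : ℕ → Fin N → FiniteMomentMeasure (Space d)}
    (hμs : Tendsto (fun n => wassersteinSum (μs n) μ) atTop (𝓝 0)) (k : Fin N) :
    Tendsto (fun n => wasserstein (μs n k) (μ k)) atTop (𝓝 0) :=
  squeeze_zero (fun _ => wasserstein_nonneg _ _)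
    (fun n => Finset.single_le_sum (f := fun k => wasserstein (μs n k) (μ k))
      (fun _ _ => wasserstein_nonneg _ _) (Finset.mem_univ k)) hμs

lemma tendsto_integral_of_tendsto_wasserstein {d : ℕ} {μ : FiniteMomentMeasure (Space d)}
    {μs : ℕ → FiniteMomentMeasure (Space d)}
    (hμs : Tendsto (fun n => wasserstein (μs n) μ) atTop (𝓝 0)) {f : Space d → ℝ} {L : NNReal}
    (hf : LipschitzWith L f) :
    Tendsto (fun n => ∫ x, f x ∂(μs n).law) atTop (𝓝 (∫ x, f x ∂μ.law)) := by
  rw [tendsto_iff_dist_tendsto_zero]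
  refine squeeze_zero (fun _ => dist_nonneg) (fun n => ?_)
    (by simpa using hμs.const_mul (L : ℝ))
  exact abs_integral_sub_le_wasserstein (μs n) μ hf

lemma tendsto_of_tendsto_wasserstein {d : ℕ} {μ : FiniteMomentMeasure (Space d)}
    {μs : ℕ → FiniteMomentMeasure (Space d)}
    (hμs : Tendsto (fun n => wasserstein (μs n) μ) atTop (𝓝 0)) :
    Tendsto (fun n => (μs n).1) atTop (𝓝 μ.1) :=
  tendsto_iff_forall_lipschitz_integral_tendsto.2 fun _ _ ⟨_, hf⟩ =>
    tendsto_integral_of_tendsto_wasserstein hμs hf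

lemma mem_transportPlans_of_tendsto {N d : ℕ} {μ : Fin N → FiniteMomentMeasure (Space d)}
    {μs : ℕ → Fin N → FiniteMomentMeasure (Space d)}
    (hμs : Tendsto (fun n => wassersteinSum (μs n) μ) atTop (𝓝 0))
    {Ps : ℕ → ProbabilityMeasure (PathSpace N d)} (hPs : ∀ n, Ps n ∈ transportPlans (μs n))
    {P : ProbabilityMeasure (PathSpace N d)} (hP : Tendsto Ps atTop (𝓝 P)) :
    P ∈ transportPlans μ := by
  refine mem_transportPlans_of_map_eq fun k => ?_
  have h1 := ProbabilityMeasure.tendsto_map_of_tendsto_of_continuous Ps P hP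
    (continuous_apply k : Continuous fun ω : PathSpace N d => ω k)
  have h2 := tendsto_of_tendsto_wasserstein (tendsto_wasserstein_of_tendsto_sum hμs k)
  have h3 : (fun n => (Ps n).map (f := fun ω : PathSpace N d => ω k)
      (continuous_apply k).measurable.aemeasurable) = fun n => (μs n k).1 :=
    funext fun n => Subtype.ext ((hPs n).2 k)
  rw [h3] at h1
  have h4 : (P.map (f := fun ω : PathSpace N d => ω k)
      (continuous_apply k).measurable.aemeasurable : ProbabilityMeasure (Space d)) = (μ k).1 :=
    tendsto_nhds_unique h1 h2
  exact congrArg (fun ν : ProbabilityMeasure (Space d) => (ν : Measure (Space d))) h4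

/-- Expectations of continuous functions of linear growth pass to weak limits of transport plans
when the marginals converge in the Wasserstein distance. -/
lemma tendsto_integral_of_linear_growth {N d : ℕ} {μ : Fin N → FiniteMomentMeasure (Space d)}
    {μs : ℕ → Fin N → FiniteMomentMeasure (Space d)}
    (hμs : Tendsto (fun n => wassersteinSum (μs n) μ) atTop (𝓝 0))
    {Ps : ℕ → ProbabilityMeasure (PathSpace N d)} (hPs : ∀ n, Ps n ∈ transportPlans (μs n))
    {P : ProbabilityMeasure (PathSpace N d)} (hP : Tendsto Ps atTop (𝓝 P))
    {c : PathSpace N d → ℝ} (hc : Continuous c) {A B : ℝ} (hB : 0 ≤ B)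
    (hcAB : ∀ ω, |c ω| ≤ A + B * ‖ω‖) :
    Tendsto (fun n => ∫ ω, c ω ∂(Ps n : Measure (PathSpace N d))) atTop
      (𝓝 (∫ ω, c ω ∂(P : Measure (PathSpace N d)))) := by
  have hPμ := mem_transportPlans_of_tendsto hμs hPs hP
  have hsum {μ : Fin N → FiniteMomentMeasure (Space d)} {Q : ProbabilityMeasure (PathSpace N d)}
      (hQ : Q ∈ transportPlans μ) :
      Integrable (fun ω : PathSpace N d => A + B * ∑ k, ‖ω k‖) (Q : Measure (PathSpace N d)) ∧
      ∫ ω, (A + B * ∑ k, ‖ω k‖) ∂(Q : Measure (PathSpace N d)) =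
        A + B * ∑ k, ∫ x, ‖x‖ ∂(μ k).law := by
    have h1 : Integrable (fun ω : PathSpace N d => B * ∑ k, ‖ω k‖)
        (Q : Measure (PathSpace N d)) :=
      (integrable_finsetSum _ fun k _ => (integrable_eval hQ.1 k).norm).const_mul _
    refine ⟨(integrable_const A).add h1, ?_⟩
    rw [integral_add (integrable_const A) h1, integral_const_mul,
      integral_finsetSum _ fun k _ => (integrable_eval hQ.1 k).norm]
    simp_rw [integral_norm_eval hQ]
    simp
  refine tendsto_integral_of_dominated hP hc (g := fun ω => A + B * ∑ k, ‖ω k‖) (by fun_prop)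
    (fun ω => (hcAB ω).trans (by gcongr; exact norm_path_le_sum ω)) (fun n => (hsum (hPs n)).1)
    (hsum hPμ).1 ?_
  simp_rw [(hsum hPμ).2, fun n => (hsum (hPs n)).2]
  refine ((tendsto_finsetSum _ fun k _ => ?_).const_mul B).const_add A
  exact tendsto_integral_of_tendsto_wasserstein (tendsto_wasserstein_of_tendsto_sum hμs k)
    lipschitzWith_one_norm

lemma tendsto_integral_of_lipschitz {N d : ℕ} {μ : Fin N → FiniteMomentMeasure (Space d)}
    {μs : ℕ → Fin N → FiniteMomentMeasure (Space d)}
    (hμs : Tendsto (fun n => wassersteinSum (μs n) μ) atTop (𝓝 0))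
    {Ps : ℕ → ProbabilityMeasure (PathSpace N d)} (hPs : ∀ n, Ps n ∈ transportPlans (μs n))
    {P : ProbabilityMeasure (PathSpace N d)} (hP : Tendsto Ps atTop (𝓝 P))
    {c : PathSpace N d → ℝ} {K : NNReal} (hc : LipschitzWith K c) :
    Tendsto (fun n => ∫ ω, c ω ∂(Ps n : Measure (PathSpace N d))) atTop
      (𝓝 (∫ ω, c ω ∂(P : Measure (PathSpace N d)))) := by
  refine tendsto_integral_of_linear_growth hμs hPs hP hc.continuous (A := ‖c 0‖) K.coe_nonneg
    fun ω => ?_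
  have h := hc.norm_sub_le ω 0
  rw [sub_zero] at h
  have := norm_le_norm_add_norm_sub' (c ω) (c 0)
  rw [Real.norm_eq_abs (c ω)] at this
  linarith

lemma mem_approxMartingaleMeasures_of_tendsto {N d : ℕ}
    {μ : Fin N → FiniteMomentMeasure (Space d)} {μs : ℕ → Fin N → FiniteMomentMeasure (Space d)}
    (hμs : Tendsto (fun n => wassersteinSum (μs n) μ) atTop (𝓝 0)) {e : ℕ → ℝ} {ε : ℝ}
    (he : Tendsto e atTop (𝓝 ε)) {Ps : ℕ → ProbabilityMeasure (PathSpace N d)}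
    (hPs : ∀ n, Ps n ∈ approxMartingaleMeasures (e n) (μs n))
    {P : ProbabilityMeasure (PathSpace N d)} (hP : Tendsto Ps atTop (𝓝 P)) :
    P ∈ approxMartingaleMeasures ε μ := by
  have hPμ := mem_transportPlans_of_tendsto hμs (fun n => (hPs n).1) hP
  refine ⟨hPμ, isApproxMartingale_of_integral_test_le hPμ.1 fun k hk g hg hb => ?_⟩
  refine le_of_tendsto_of_tendsto' (tendsto_integral_of_linear_growth hμs (fun n => (hPs n).1) hP
    (A := 0) (B := 2) ?_ zero_le_two fun ω => ?_) he
    fun n => (hPs n).2.integral_test_le (hPs n).1.1 k hk hg.measurable hb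
  · refine continuous_finsetSum _ fun i _ => ?_
    exact ((continuous_apply i).comp (hg.comp (continuous_past k))).mul
      ((PiLp.proj 1 (fun _ : Fin d => ℝ) i : Space d →L[ℝ] ℝ).continuous.comp
        (continuous_increment k hk))
  · have h1 := sum_mul_coord_le_norm (hb (past k ω)) (increment k hk ω)
    have h2 := sum_mul_coord_le_norm (g := fun i => -g (past k ω) i)
      (fun i => by rw [abs_neg]; exact hb _ i) (increment k hk ω)
    simp only [neg_mul, Finset.sum_neg_distrib] at h2
    have h3 : ‖increment k hk ω‖ ≤ 2 * ‖ω‖ := by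
      refine (norm_sub_le _ _).trans ?_
      linarith [norm_le_pi_norm ω k, norm_le_pi_norm ω ⟨(k : ℕ) + 1, hk⟩]
    exact abs_le.2 ⟨by linarith, by linarith⟩

/-- Transport plans whose marginals converge in the Wasserstein distance are tight, because their
first moments are bounded. -/
lemma isTightMeasureSet_transportPlans {N d : ℕ} {μ : Fin N → FiniteMomentMeasure (Space d)}
    {μs : ℕ → Fin N → FiniteMomentMeasure (Space d)}
    (hμs : Tendsto (fun n => wassersteinSum (μs n) μ) atTop (𝓝 0))
    {Ps : ℕ → ProbabilityMeasure (PathSpace N d)} (hPs : ∀ n, Ps n ∈ transportPlans (μs n)) :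
    IsTightMeasureSet (Set.range fun n => (Ps n : Measure (PathSpace N d))) := by
  have hlim : Tendsto (fun n => ∑ k, ∫ x, ‖x‖ ∂(μs n k).law) atTop
      (𝓝 (∑ k, ∫ x, ‖x‖ ∂(μ k).law)) :=
    tendsto_finsetSum _ fun k _ => tendsto_integral_of_tendsto_wasserstein
      (tendsto_wasserstein_of_tendsto_sum hμs k) lipschitzWith_one_norm
  obtain ⟨C, hC⟩ := hlim.bddAbove_range
  have hmom (n : ℕ) : ∫ ω, ‖ω‖ ∂(Ps n : Measure (PathSpace N d)) ≤ C := by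
    have hi := fun k (_ : k ∈ Finset.univ) => (integrable_eval (hPs n).1 k).norm
    calc ∫ ω, ‖ω‖ ∂(Ps n : Measure (PathSpace N d))
        ≤ ∫ ω, ∑ k, ‖ω k‖ ∂(Ps n : Measure (PathSpace N d)) :=
          integral_mono (hPs n).1 (integrable_finsetSum _ hi) norm_path_le_sum
      _ = ∑ k, ∫ x, ‖x‖ ∂(μs n k).law := by
          rw [integral_finsetSum _ hi]
          simp_rw [integral_norm_eval (hPs n)]
      _ ≤ C := hC ⟨n, rfl⟩
  refine isTightMeasureSet_of_tendsto_measure_norm_gt ?_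
  have hz : Tendsto (fun r : ℝ => ENNReal.ofReal (C / r)) atTop (𝓝 0) := by
    rw [← ENNReal.ofReal_zero]
    exact ENNReal.tendsto_ofReal (tendsto_const_nhds.div_atTop tendsto_id)
  refine tendsto_of_tendsto_of_tendsto_of_le_of_le' tendsto_const_nhds hz
    (Eventually.of_forall fun _ => zero_le) ?_
  filter_upwards [eventually_gt_atTop 0] with r hr
  rw [iSup_range]
  refine iSup_le fun n => ?_
  have h1 := mul_meas_ge_le_integral_of_nonneg (μ := (Ps n : Measure (PathSpace N d)))
    (Eventually.of_forall fun ω => norm_nonneg ω) (hPs n).1 r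
  have h2 : (Ps n : Measure (PathSpace N d)).real {ω | r ≤ ‖ω‖} ≤ C / r := by
    rw [le_div_iff₀ hr, mul_comm]
    exact h1.trans (hmom n)
  calc (Ps n : Measure (PathSpace N d)) {ω | r < ‖ω‖}
      ≤ (Ps n : Measure (PathSpace N d)) {ω | r ≤ ‖ω‖} :=
        measure_mono fun ω (hω : r < ‖ω‖) => hω.le
    _ = ENNReal.ofReal ((Ps n : Measure (PathSpace N d)).real {ω | r ≤ ‖ω‖}) :=
        (ofReal_measureReal).symm
    _ ≤ ENNReal.ofReal (C / r) := ENNReal.ofReal_le_ofReal h2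

/-- Sequential compactness: approximating martingale measures whose marginals and tolerances
converge have a weakly convergent subsequence, and its limit is an approximating martingale measure
for the limiting data. -/
lemma exists_tendsto_subseq {N d : ℕ}
    {μ : Fin N → FiniteMomentMeasure (Space d)} {μs : ℕ → Fin N → FiniteMomentMeasure (Space d)}
    (hμs : Tendsto (fun n => wassersteinSum (μs n) μ) atTop (𝓝 0)) {e : ℕ → ℝ} {ε : ℝ}
    (he : Tendsto e atTop (𝓝 ε)) {Ps : ℕ → ProbabilityMeasure (PathSpace N d)}
    (hPs : ∀ n, Ps n ∈ approxMartingaleMeasures (e n) (μs n)) :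
    ∃ P ∈ approxMartingaleMeasures ε μ, ∃ φ : ℕ → ℕ, StrictMono φ ∧
      Tendsto (Ps ∘ φ) atTop (𝓝 P) ∧
      ∀ (c : PathSpace N d → ℝ) (K : NNReal), LipschitzWith K c →
        Tendsto (fun n => ∫ ω, c ω ∂(Ps (φ n) : Measure (PathSpace N d))) atTop
          (𝓝 (∫ ω, c ω ∂(P : Measure (PathSpace N d)))) := by
  have htight := isTightMeasureSet_transportPlans hμs fun n => (hPs n).1
  have hset : {((Q : ProbabilityMeasure (PathSpace N d)) : Measure (PathSpace N d)) |
      Q ∈ Set.range Ps} = Set.range fun n => (Ps n : Measure (PathSpace N d)) := by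
    ext; simp
  have hcomp := isCompact_closure_of_isTightMeasureSet (S := Set.range Ps) (hset ▸ htight)
  obtain ⟨P, -, φ, hφ, hP⟩ := hcomp.tendsto_subseq fun n => subset_closure ⟨n, rfl⟩
  have hμs' := hμs.comp hφ.tendsto_atTop
  exact ⟨P, mem_approxMartingaleMeasures_of_tendsto (μs := μs ∘ φ) hμs' (he.comp hφ.tendsto_atTop)
    (fun n => hPs (φ n)) hP, φ, hφ, hP, fun c K hc =>
    tendsto_integral_of_lipschitz (μs := μs ∘ φ) hμs' (fun n => (hPs (φ n)).1) hP hc⟩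

/-! ### Existence and stability of optimizers -/

/-- An approximating martingale measure can be moved to other marginals at the cost of exactly the
Wasserstein distance. Compactness stands in for the existence of optimal couplings. -/
lemma exists_approxMartingale_wassersteinSum {N d : ℕ} {ε : ℝ}
    {μ : Fin N → FiniteMomentMeasure (Space d)} (ν : Fin N → FiniteMomentMeasure (Space d))
    {P : ProbabilityMeasure (PathSpace N d)} (hP : P ∈ approxMartingaleMeasures ε μ) :
    ∃ P' ∈ approxMartingaleMeasures (ε + wassersteinSum μ ν) ν,
      ∀ (c : PathSpace N d → ℝ) (K : NNReal), LipschitzWith K c →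
        ∫ ω, c ω ∂(P : Measure (PathSpace N d)) ≤ ∫ ω, c ω ∂(P' : Measure (PathSpace N d)) +
          K * wassersteinSum μ ν := by
  choose Ps hPs hval using fun n : ℕ =>
    exists_approxMartingale_add (ν := ν) hP (Nat.one_div_pos_of_nat (α := ℝ) (n := n))
  have hδ : Tendsto (fun n : ℕ => wassersteinSum μ ν + 1 / ((n : ℝ) + 1)) atTop
      (𝓝 (wassersteinSum μ ν)) := by
    simpa using tendsto_one_div_add_atTop_nhds_zero_nat.const_add (wassersteinSum μ ν)
  obtain ⟨P', hP', φ, hφ, -, hlim⟩ := exists_tendsto_subseq (μ := ν) (μs := fun _ => ν)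
    (by simp [wassersteinSum_self]) (hδ.const_add ε) hPs
  refine ⟨P', hP', fun c K hc => ?_⟩
  exact ge_of_tendsto' ((hlim c K hc).add ((hδ.comp hφ.tendsto_atTop).const_mul (K : ℝ)))
    fun n => hval (φ n) c K hc

lemma integral_le_of_isOptimizer {N d : ℕ} {c : PathSpace N d → ℝ} {ε : ℝ}
    {μ : Fin N → FiniteMomentMeasure (Space d)} {P Q : ProbabilityMeasure (PathSpace N d)}
    (hP : IsOptimizer c ε μ P) (hQ : Q ∈ approxMartingaleMeasures ε μ) :
    ∫ ω, c ω ∂(Q : Measure (PathSpace N d)) ≤ ∫ ω, c ω ∂(P : Measure (PathSpace N d)) := by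
  rw [← EReal.coe_le_coe_iff, ← hP.2]
  exact le_iSup₂ (f := fun (P : ProbabilityMeasure (PathSpace N d))
    (_ : P ∈ approxMartingaleMeasures ε μ) =>
      ((∫ ω, c ω ∂(P : Measure (PathSpace N d)) : ℝ) : EReal)) Q hQ

lemma isOptimizer_of_forall_le {N d : ℕ} {c : PathSpace N d → ℝ} {ε : ℝ}
    {μ : Fin N → FiniteMomentMeasure (Space d)} {P : ProbabilityMeasure (PathSpace N d)}
    (hP : P ∈ approxMartingaleMeasures ε μ)
    (h : ∀ Q ∈ approxMartingaleMeasures ε μ,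
      ∫ ω, c ω ∂(Q : Measure (PathSpace N d)) ≤ ∫ ω, c ω ∂(P : Measure (PathSpace N d))) :
    IsOptimizer c ε μ P :=
  ⟨hP, le_antisymm (iSup₂_le fun Q hQ => EReal.coe_le_coe_iff.2 (h Q hQ))
    (le_iSup₂ (f := fun (P : ProbabilityMeasure (PathSpace N d))
      (_ : P ∈ approxMartingaleMeasures ε μ) =>
        ((∫ ω, c ω ∂(P : Measure (PathSpace N d)) : ℝ) : EReal)) P hP)⟩

lemma exists_isOptimizer {N d : ℕ} {c : PathSpace N d → ℝ} {K : NNReal} (hc : LipschitzWith K c)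
    {ε : ℝ} {μ : Fin N → FiniteMomentMeasure (Space d)}
    (hne : (approxMartingaleMeasures ε μ).Nonempty) : ∃ P, IsOptimizer c ε μ P := by
  have hval : relaxedValue c ε μ = sSup ((fun P : ProbabilityMeasure (PathSpace N d) =>
      ((∫ ω, c ω ∂(P : Measure (PathSpace N d)) : ℝ) : EReal)) '' approxMartingaleMeasures ε μ) :=
    sSup_image.symm
  obtain ⟨u, -, hu, hmem⟩ := exists_seq_tendsto_sSup (hne.image
    (fun P : ProbabilityMeasure (PathSpace N d) =>
      ((∫ ω, c ω ∂(P : Measure (PathSpace N d)) : ℝ) : EReal))) (OrderTop.bddAbove _)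
  choose Ps hPs hPu using hmem
  obtain ⟨P, hP, φ, hφ, -, hlim⟩ := exists_tendsto_subseq (μ := μ) (μs := fun _ => μ)
    (by simp [wassersteinSum_self]) (tendsto_const_nhds (x := ε)) hPs
  refine ⟨P, hP, ?_⟩
  rw [hval]
  refine tendsto_nhds_unique (hu.comp hφ.tendsto_atTop) ?_
  refine ((continuous_coe_real_ereal.tendsto _).comp (hlim c K hc)).congr fun n => ?_
  exact hPu (φ n)

/-- Weak limits of optimizers for perturbed data are optimizers for the limiting martingale
transport problem: every competitor in the limit is a limit, in value, of competitors for the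
perturbed data. -/
lemma isOptimizer_of_tendsto {N d : ℕ} {c : PathSpace N d → ℝ} {K : NNReal}
    (hc : LipschitzWith K c) {μ : Fin N → FiniteMomentMeasure (Space d)}
    {μs : ℕ → Fin N → FiniteMomentMeasure (Space d)}
    (hμs : Tendsto (fun n => wassersteinSum (μs n) μ) atTop (𝓝 0)) {ε : ℕ → ℝ}
    (hε : Tendsto ε atTop (𝓝 0)) (hle : ∀ n, wassersteinSum (μs n) μ ≤ ε n)
    {P : ℕ → ProbabilityMeasure (PathSpace N d)} (hP : ∀ n, IsOptimizer c (ε n) (μs n) (P n))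
    {Q : ProbabilityMeasure (PathSpace N d)} (hQ : Tendsto P atTop (𝓝 Q)) :
    IsOptimizer c 0 μ Q := by
  refine isOptimizer_of_forall_le
    (mem_approxMartingaleMeasures_of_tendsto hμs hε (fun n => (hP n).1) hQ) fun R hR => ?_
  have hlim := (tendsto_integral_of_lipschitz hμs (fun n => (hP n).1.1) hQ hc).add
    (hμs.const_mul (K : ℝ))
  rw [mul_zero, add_zero] at hlim
  refine ge_of_tendsto' hlim fun n => ?_
  obtain ⟨R', hR', hval⟩ := exists_approxMartingale_wassersteinSum (μs n) hR
  rw [zero_add, wassersteinSum_comm] at hR'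
  have h1 := hval c K hc
  rw [wassersteinSum_comm] at h1
  have h2 := integral_le_of_isOptimizer (hP n)
    ⟨hR'.1, fun k hk => (hR'.2 k hk).trans (hle n)⟩
  linarith

/-- Every subsequence of a sequence of optimizers for perturbed data has a further subsequence
which converges weakly and in value to an optimizer of the limiting problem. -/
lemma exists_subseq_tendsto_isOptimizer {N d : ℕ} {c : PathSpace N d → ℝ} {K : NNReal}
    (hc : LipschitzWith K c) {μ : Fin N → FiniteMomentMeasure (Space d)}
    {μs : ℕ → Fin N → FiniteMomentMeasure (Space d)}
    (hμs : Tendsto (fun n => wassersteinSum (μs n) μ) atTop (𝓝 0)) {ε : ℕ → ℝ}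
    (hε : Tendsto ε atTop (𝓝 0)) (hle : ∀ n, wassersteinSum (μs n) μ ≤ ε n)
    {P : ℕ → ProbabilityMeasure (PathSpace N d)} (hP : ∀ n, IsOptimizer c (ε n) (μs n) (P n))
    {ns : ℕ → ℕ} (hns : Tendsto ns atTop atTop) :
    ∃ (Q : ProbabilityMeasure (PathSpace N d)) (φ : ℕ → ℕ), IsOptimizer c 0 μ Q ∧
      Tendsto (fun n => P (ns (φ n))) atTop (𝓝 Q) ∧
      Tendsto (fun n => relaxedValue c (ε (ns (φ n))) (μs (ns (φ n)))) atTop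
        (𝓝 (relaxedValue c 0 μ)) := by
  obtain ⟨Q, -, φ, hφ, hQ, hlim⟩ := exists_tendsto_subseq (μs := μs ∘ ns) (hμs.comp hns)
    (hε.comp hns) fun n => (hP (ns n)).1
  have hnφ := hns.comp hφ.tendsto_atTop
  have hopt : IsOptimizer c 0 μ Q := isOptimizer_of_tendsto hc (μs := μs ∘ ns ∘ φ)
    (hμs.comp hnφ) (hε.comp hnφ) (fun n => hle _) (fun n => hP (ns (φ n))) hQ
  refine ⟨Q, φ, hopt, hQ, ?_⟩
  rw [hopt.2]
  simp_rw [fun n => (hP n).2]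
  exact (continuous_coe_real_ereal.tendsto _).comp (hlim c K hc)

end RelaxedMOT

end

theorem mainTheorem1 (N d : ℕ) (hN : 2 ≤ N) (hd : 1 ≤ d)
    (μ : Fin N → RelaxedMOT.FiniteMomentMeasure (RelaxedMOT.Space d))
    (hμ : (RelaxedMOT.approxMartingaleMeasures 0 μ).Nonempty)
    (μs : ℕ → Fin N → RelaxedMOT.FiniteMomentMeasure (RelaxedMOT.Space d))
    (hμs : Tendsto (fun n => RelaxedMOT.wassersteinSum (μs n) μ) atTop (𝓝 0)) :
    (∀ n, (RelaxedMOT.approxMartingaleMeasures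
        (RelaxedMOT.wassersteinSum (μs n) μ) (μs n)).Nonempty) ∧
    ∀ c : RelaxedMOT.PathSpace N d → ℝ, (∃ K : NNReal, LipschitzWith K c) →
    ∀ ε : ℕ → ℝ, Tendsto ε atTop (𝓝 0) →
      (∀ n, RelaxedMOT.wassersteinSum (μs n) μ ≤ ε n) →
      Tendsto (fun n => RelaxedMOT.relaxedValue c (ε n) (μs n)) atTop
        (𝓝 (RelaxedMOT.relaxedValue c 0 μ)) ∧
      (∀ n, ∃ P, RelaxedMOT.IsOptimizer c (ε n) (μs n) P) ∧
      ∀ P : ℕ → ProbabilityMeasure (RelaxedMOT.PathSpace N d),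
        (∀ n, RelaxedMOT.IsOptimizer c (ε n) (μs n) (P n)) →
        IsTightMeasureSet
          (Set.range fun n => ((P n : ProbabilityMeasure (RelaxedMOT.PathSpace N d)) :
            Measure (RelaxedMOT.PathSpace N d))) ∧
        (∀ (Q : ProbabilityMeasure (RelaxedMOT.PathSpace N d)) (φ : ℕ → ℕ), StrictMono φ →
          Tendsto (P ∘ φ) atTop (𝓝 Q) → RelaxedMOT.IsOptimizer c 0 μ Q) ∧
        (∀ Q : ProbabilityMeasure (RelaxedMOT.PathSpace N d), RelaxedMOT.IsOptimizer c 0 μ Q →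
          (∀ Q', RelaxedMOT.IsOptimizer c 0 μ Q' → Q' = Q) →
          Tendsto P atTop (𝓝 Q)) := by
  have hne (n : ℕ) : (RelaxedMOT.approxMartingaleMeasures
      (RelaxedMOT.wassersteinSum (μs n) μ) (μs n)).Nonempty := by
    obtain ⟨P, hP⟩ := hμ
    obtain ⟨P', hP', -⟩ := RelaxedMOT.exists_approxMartingale_wassersteinSum (μs n) hP
    rw [zero_add, RelaxedMOT.wassersteinSum_comm] at hP'
    exact ⟨P', hP'⟩
  refine ⟨hne, ?_⟩
  rintro c ⟨K, hc⟩ ε hε hle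
  have hopt (n : ℕ) : ∃ P, RelaxedMOT.IsOptimizer c (ε n) (μs n) P := by
    obtain ⟨P, hP⟩ := hne n
    exact RelaxedMOT.exists_isOptimizer hc ⟨P, hP.1, fun k hk => (hP.2 k hk).trans (hle n)⟩
  refine ⟨?_, hopt, fun P hP => ⟨?_, fun Q φ hφ hQ => ?_, fun Q hQ huniq => ?_⟩⟩
  · choose P hP using hopt
    refine tendsto_of_subseq_tendsto fun ns hns => ?_
    obtain ⟨-, φ, -, -, h⟩ :=
      RelaxedMOT.exists_subseq_tendsto_isOptimizer hc hμs hε hle hP hns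
    exact ⟨φ, h⟩
  · exact RelaxedMOT.isTightMeasureSet_transportPlans hμs fun n => (hP n).1.1
  · exact RelaxedMOT.isOptimizer_of_tendsto hc (μs := μs ∘ φ) (hμs.comp hφ.tendsto_atTop)
      (hε.comp hφ.tendsto_atTop) (fun n => hle _) (fun n => hP (φ n)) hQ
  · refine tendsto_of_subseq_tendsto fun ns hns => ?_
    obtain ⟨Q', φ, hQ', h, -⟩ :=
      RelaxedMOT.exists_subseq_tendsto_isOptimizer hc hμs hε hle hP hns
    exact ⟨φ, huniq Q' hQ' ▸ h⟩
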